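/- Let $N\ge 1$ be an integer, let $\alpha>0$ with $2\alpha<N$, and put $2_\alpha^*=\frac{2N}{N-2\alpha}$. Let $$G_\alpha(x)=\frac{1}{(4\pi)^{\alpha/2}\Gamma(\alpha/2)}\int_0^\infty e^{-\frac{\pi}{t}|x|^2}\,e^{-\frac{t}{4\pi}}\,t^{\frac{\alpha-N}{2}-1}\,dt$$ be the Bessel kernel on $\mathbb{R}^N$, and let $L^{\alpha,2}(\mathbb{R}^N)=\{G_\alpha*g : g\in L^2(\mathbb{R}^N)\}$ (real-valued functions) be the Bessel space with norm $\|G_\alpha*g\|=\|g\|_{L^2}$. Let $c\in L^\infty(\mathbb{R}^N)$ be a function with $c(x)>0$ for every $x$ that satisfies condition (K): for every sequence $(A_n)_n$ of Borel subsets of $\mathbb{R}^N$ with $\sup_n\mathcal{L}^N(A_n)<\infty$, $$\lim_{r\to+\infty}\int_{A_n\setminus B(0,r)}c(x)\,dx=0\quad\text{uniformly with respect to } n.$$ Then for every real $q$ with $2<q<2_\alpha^*$ the space $L^{\alpha,2}(\mathbb{R}^N)$ is compactly embedded into the weighted space $L^q(c\,dx)=\{u:\int_{\mathbb{R}^N}|u|^q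 c\,dx<\infty\}$; that is, every $u\in L^{\alpha,2}(\mathbb{R}^N)$ belongs to $L^q(c\,dx)$, and the inclusion map $L^{\alpha,2}(\mathbb{R}^N)\to L^q(c\,dx)$ is an injective, continuous and compact linear operator. -/

import Mathlib

open MeasureTheory Filter Topology
open scoped Convolution FourierTransform SchwartzMap

noncomputable section

/-- The integrand of the Bessel kernel of order `α` on `ℝ^N`. -/
def besselIntegrand (N : ℕ) (α : ℝ) (x : EuclideanSpace ℝ (Fin N)) (t : ℝ) : ℝ :=
  Real.exp (-(Real.pi / t) * ‖x‖ ^ 2) * Real.exp (-(t / (4 * Real.pi))) *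
    t ^ ((α - N) / 2 - 1)

/-- The Bessel kernel `G_α` on `ℝ^N`, which equals `(4π)^(-α/2) Γ(α/2)⁻¹` times the integral over
`t > 0` of `exp (-π|x|²/t) exp (-t/(4π)) t^((α-N)/2-1)`. -/
def besselKernel (N : ℕ) (α : ℝ) (x : EuclideanSpace ℝ (Fin N)) : ℝ :=
  1 / ((4 * Real.pi) ^ (α / 2) * Real.Gamma (α / 2)) *
    ∫ t in Set.Ioi (0 : ℝ), besselIntegrand N α x t

section

variable {N : ℕ} {α : ℝ}

theorem besselIntegrand_nonneg (x : EuclideanSpace ℝ (Fin N)) {t : ℝ} (ht : 0 < t) :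
    0 ≤ besselIntegrand N α x t := by
  unfold besselIntegrand; positivity

theorem besselKernel_nonneg (hα : 0 < α) (x : EuclideanSpace ℝ (Fin N)) :
    0 ≤ besselKernel N α x := by
  unfold besselKernel
  have := Real.Gamma_pos_of_pos (half_pos hα)
  refine mul_nonneg (by positivity) (setIntegral_nonneg measurableSet_Ioi ?_)
  intro t ht
  exact besselIntegrand_nonneg x ht

theorem besselKernel_neg (x : EuclideanSpace ℝ (Fin N)) :
    besselKernel N α (-x) = besselKernel N α x := by
  simp [besselKernel, besselIntegrand]

theorem measurable_besselIntegrand :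
    Measurable (Function.uncurry (besselIntegrand N α)) := by
  unfold besselIntegrand Function.uncurry
  fun_prop

theorem bessel_rpow {t : ℝ} (ht : 0 < t) :
    t ^ ((α - N) / 2 - 1) * t ^ ((N : ℝ) / 2) = t ^ (α / 2 - 1) := by
  rw [← Real.rpow_add ht]; congr 1; ring

theorem integral_besselIntegrand {t : ℝ} (ht : 0 < t) :
    ∫ x : EuclideanSpace ℝ (Fin N), besselIntegrand N α x t =
      t ^ (α / 2 - 1) * Real.exp (-(1 / (4 * Real.pi) * t)) := by
  have h := GaussianFourier.integral_rexp_neg_mul_sq_norm (V := EuclideanSpace ℝ (Fin N))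
    (b := Real.pi / t) (by positivity)
  simp only [besselIntegrand]
  rw [integral_mul_const, integral_mul_const, h, ← bessel_rpow (N := N) (α := α) ht]
  have : Real.pi / (Real.pi / t) = t := by field_simp
  rw [this, finrank_euclideanSpace_fin, show t / (4 * Real.pi) = 1 / (4 * Real.pi) * t by ring]
  ring

theorem integrable_besselIntegrand {t : ℝ} (ht : 0 < t) :
    Integrable (fun x : EuclideanSpace ℝ (Fin N) ↦ besselIntegrand N α x t) := by
  apply Integrable.of_integral_ne_zero
  rw [integral_besselIntegrand ht]
  positivity

theorem integrable_uncurry_besselIntegrand (hα : 0 < α) :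
    Integrable (Function.uncurry (besselIntegrand N α))
      (volume.prod (volume.restrict (Set.Ioi (0 : ℝ)))) := by
  rw [integrable_prod_iff' measurable_besselIntegrand.aestronglyMeasurable]
  constructor
  · filter_upwards [ae_restrict_mem measurableSet_Ioi] with t ht
    exact integrable_besselIntegrand ht
  · have h : Integrable (fun t : ℝ ↦ t ^ (α / 2 - 1) * Real.exp (-(1 / (4 * Real.pi) * t)))
        (volume.restrict (Set.Ioi 0)) := by
      apply Integrable.of_integral_ne_zero
      rw [Real.integral_rpow_mul_exp_neg_mul_Ioi (half_pos hα) (by positivity)]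
      have := Real.Gamma_pos_of_pos (half_pos hα)
      positivity
    refine h.congr ?_
    filter_upwards [ae_restrict_mem measurableSet_Ioi] with t ht
    rw [← integral_besselIntegrand (N := N) ht]
    refine integral_congr_ae (ae_of_all _ fun x ↦ ?_)
    simp [Function.uncurry, abs_of_nonneg (besselIntegrand_nonneg x ht)]

theorem integrable_besselKernel (hα : 0 < α) : Integrable (besselKernel N α) :=
  (integrable_uncurry_besselIntegrand hα).integral_prod_left.const_mul _

/-- The Fourier transform of the Bessel kernel, in the normalisation
`𝓕 f ξ = ∫ f x * exp (-2πi ⟨x, ξ⟩)`. -/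
theorem fourier_besselKernel (hα : 0 < α) (ξ : EuclideanSpace ℝ (Fin N)) :
    𝓕 (fun x ↦ (besselKernel N α x : ℂ)) ξ =
      (((1 + ‖(2 * Real.pi) • ξ‖ ^ 2) ^ (-(α / 2)) : ℝ) : ℂ) := by
  have hint : Integrable (Function.uncurry fun (x : EuclideanSpace ℝ (Fin N)) (t : ℝ) ↦
      Real.fourierChar (-inner ℝ x ξ) • (besselIntegrand N α x t : ℂ))
      (volume.prod (volume.restrict (Set.Ioi (0 : ℝ)))) := by
    refine (integrable_uncurry_besselIntegrand (N := N) hα).mono ?_ ?_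
    · refine AEStronglyMeasurable.smul (f := fun p : EuclideanSpace ℝ (Fin N) × ℝ ↦
        Real.fourierChar (-inner ℝ p.1 ξ))
        (g := fun p : EuclideanSpace ℝ (Fin N) × ℝ ↦ (besselIntegrand N α p.1 p.2 : ℂ)) ?_ ?_
      · exact (Real.continuous_fourierChar.comp (by fun_prop)).aestronglyMeasurable
      · exact (Complex.measurable_ofReal.comp measurable_besselIntegrand).aestronglyMeasurable
    · exact ae_of_all _ fun p ↦ by simp [Function.uncurry]
  have hpi := Real.pi_pos
  have hG := Real.Gamma_pos_of_pos (half_pos hα)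
  have h1 : ∀ t : ℝ, 0 < t → ∫ x : EuclideanSpace ℝ (Fin N),
      Real.fourierChar (-inner ℝ x ξ) • (besselIntegrand N α x t : ℂ) =
      ((t ^ (α / 2 - 1) * Real.exp (-((1 / (4 * Real.pi) + Real.pi * ‖ξ‖ ^ 2) * t)) : ℝ) : ℂ) := by
    intro t ht
    have h := fourier_gaussian_innerProductSpace (V := EuclideanSpace ℝ (Fin N))
      (b := ((Real.pi / t : ℝ) : ℂ)) (by simpa using by positivity) ξ
    rw [Real.fourier_eq] at h
    have e1 : ∀ x : EuclideanSpace ℝ (Fin N),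
        Real.fourierChar (-inner ℝ x ξ) • (besselIntegrand N α x t : ℂ) =
        (Real.fourierChar (-inner ℝ x ξ) • Complex.exp (-((Real.pi / t : ℝ) : ℂ) * ‖x‖ ^ 2)) *
        ((Real.exp (-(t / (4 * Real.pi))) * t ^ ((α - N) / 2 - 1) : ℝ) : ℂ) := by
      intro x
      rw [smul_mul_assoc]
      congr 1
      simp only [besselIntegrand]
      push_cast
      ring
    simp_rw [e1]
    rw [integral_mul_const, h, ← bessel_rpow (N := N) (α := α) ht]
    have e2 : ((Real.pi : ℂ) / ((Real.pi / t : ℝ) : ℂ)) = (t : ℂ) := by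
      have : (t : ℂ) ≠ 0 := by exact_mod_cast ht.ne'
      have : (Real.pi : ℂ) ≠ 0 := by exact_mod_cast hpi.ne'
      push_cast; field_simp
    have e3 : (-(Real.pi : ℂ) ^ 2 * ‖ξ‖ ^ 2 / ((Real.pi / t : ℝ) : ℂ)) =
        ((-(Real.pi * ‖ξ‖ ^ 2 * t) : ℝ) : ℂ) := by
      have : (t : ℂ) ≠ 0 := by exact_mod_cast ht.ne'
      have : (Real.pi : ℂ) ≠ 0 := by exact_mod_cast hpi.ne'
      push_cast; field_simp
    have e4 : ((t : ℂ) ^ ((N : ℂ) / 2)) = ((t ^ ((N : ℝ) / 2) : ℝ) : ℂ) := by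
      rw [Complex.ofReal_cpow ht.le]; push_cast; rfl
    rw [e2, e3, finrank_euclideanSpace_fin, e4, ← Complex.ofReal_exp]
    have e5 : Real.exp (-((1 / (4 * Real.pi) + Real.pi * ‖ξ‖ ^ 2) * t)) =
        Real.exp (-(Real.pi * ‖ξ‖ ^ 2 * t)) * Real.exp (-(t / (4 * Real.pi))) := by
      rw [← Real.exp_add]; congr 1; ring
    rw [e5]
    push_cast
    ring
  have hr : 0 < 1 / (4 * Real.pi) + Real.pi * ‖ξ‖ ^ 2 := by positivity
  rw [Real.fourier_eq]
  have e0 : ∀ x : EuclideanSpace ℝ (Fin N),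
      Real.fourierChar (-inner ℝ x ξ) • (besselKernel N α x : ℂ) =
      ((1 / ((4 * Real.pi) ^ (α / 2) * Real.Gamma (α / 2)) : ℝ) : ℂ) *
      ∫ t in Set.Ioi (0 : ℝ), Real.fourierChar (-inner ℝ x ξ) • (besselIntegrand N α x t : ℂ) := by
    intro x
    simp only [Circle.smul_def, integral_smul, besselKernel]
    rw [integral_complex_ofReal]
    push_cast
    simp only [smul_eq_mul]
    ring
  simp_rw [e0]
  rw [integral_const_mul, integral_integral_swap hint,
    setIntegral_congr_fun measurableSet_Ioi (fun t ht ↦ h1 t ht), integral_complex_ofReal,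
    Real.integral_rpow_mul_exp_neg_mul_Ioi (half_pos hα) hr, ← Complex.ofReal_mul]
  congr 1
  have e6 : 1 / (4 * Real.pi) + Real.pi * ‖ξ‖ ^ 2 =
      (1 + ‖(2 * Real.pi) • ξ‖ ^ 2) / (4 * Real.pi) := by
    rw [norm_smul, Real.norm_of_nonneg (by positivity)]
    field_simp
    ring
  have e7 : (0 : ℝ) < 1 + ‖(2 * Real.pi) • ξ‖ ^ 2 := by positivity
  rw [e6, one_div_div, Real.div_rpow (by positivity) e7.le, Real.rpow_neg e7.le]
  have : (0 : ℝ) < (1 + ‖(2 * Real.pi) • ξ‖ ^ 2) ^ (α / 2) := by positivity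
  have : (0 : ℝ) < (4 * Real.pi) ^ (α / 2) := by positivity
  field_simp

theorem integral_besselKernel (hα : 0 < α) :
    ∫ x : EuclideanSpace ℝ (Fin N), besselKernel N α x = 1 := by
  have h := fourier_besselKernel (N := N) hα 0
  rw [Real.fourier_eq] at h
  simp only [inner_zero_right, neg_zero, AddChar.map_zero_eq_one, one_smul, smul_zero, norm_zero,
    ne_eq, OfNat.ofNat_ne_zero, not_false_eq_true, zero_pow, add_zero, Real.one_rpow] at h
  rw [integral_complex_ofReal] at h
  exact_mod_cast h

open ContinuousLinearMap (mul)

/-- For `g ∈ L²` the integral defining `(G_α * g)(x)` converges for almost every `x`. -/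
theorem ae_convolutionExistsAt_besselKernel (hα : 0 < α) {g : EuclideanSpace ℝ (Fin N) → ℝ}
    (hg : MemLp g 2 volume) :
    ∀ᵐ x, Integrable (fun t ↦ besselKernel N α t * g (x - t)) ∧
      Integrable (fun t ↦ besselKernel N α t * g (x - t) ^ 2) := by
  have hG := integrable_besselKernel (N := N) hα
  have hsq : Integrable (fun x ↦ g x ^ 2) := (memLp_two_iff_integrable_sq hg.1).1 hg
  filter_upwards [hG.ae_convolution_exists (mul ℝ ℝ) hsq] with x hx
  have hx' : Integrable (fun t ↦ besselKernel N α t * g (x - t) ^ 2) := hx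
  refine ⟨(hG.add hx').mono ?_ ?_, hx'⟩
  · refine hG.aestronglyMeasurable.mul ?_
    exact hg.1.comp_quasiMeasurePreserving (quasiMeasurePreserving_sub_left volume x)
  · refine ae_of_all _ fun t ↦ ?_
    have h0 := besselKernel_nonneg (N := N) hα t
    simp only [Pi.add_apply]
    rw [norm_mul, Real.norm_of_nonneg h0, Real.norm_eq_abs, Real.norm_of_nonneg (by positivity)]
    have : |g (x - t)| ≤ 1 + g (x - t) ^ 2 := by
      nlinarith [sq_abs (g (x - t)), abs_nonneg (g (x - t)), sq_nonneg (|g (x - t)| - 1)]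
    calc _ ≤ besselKernel N α t * (1 + g (x - t) ^ 2) := by gcongr
      _ = _ := by ring

theorem aestronglyMeasurable_besselKernel_convolution (hα : 0 < α)
    {g : EuclideanSpace ℝ (Fin N) → ℝ} (hg : MemLp g 2 volume) :
    AEStronglyMeasurable (besselKernel N α ⋆[mul ℝ ℝ] g) volume :=
  ((integrable_besselKernel hα).aestronglyMeasurable.convolution_integrand
    (mul ℝ ℝ) hg.1).integral_prod_right'

theorem sq_besselKernel_convolution_le (hα : 0 < α)
    {g : EuclideanSpace ℝ (Fin N) → ℝ} (hg : MemLp g 2 volume) :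
    ∀ᵐ x, (besselKernel N α ⋆[mul ℝ ℝ] g) x ^ 2 ≤
      (besselKernel N α ⋆[mul ℝ ℝ] (fun y ↦ g y ^ 2)) x := by
  have hG := integrable_besselKernel (N := N) hα
  filter_upwards [ae_convolutionExistsAt_besselKernel hα hg] with x ⟨h1, h2⟩
  simp only [convolution, ContinuousLinearMap.mul_apply']
  set m := ∫ t, besselKernel N α t * g (x - t)
  have h3 : 0 ≤ ∫ t, besselKernel N α t * (g (x - t) - m) ^ 2 :=
    integral_nonneg fun t ↦ mul_nonneg (besselKernel_nonneg hα t) (sq_nonneg _)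
  have h4 : ∀ t, besselKernel N α t * (g (x - t) - m) ^ 2 =
      besselKernel N α t * g (x - t) ^ 2 - (2 * m) * (besselKernel N α t * g (x - t)) +
      m ^ 2 * besselKernel N α t := fun t ↦ by ring
  simp_rw [h4] at h3
  have h5 : Integrable (fun t ↦ besselKernel N α t * g (x - t) ^ 2 -
      (2 * m) * (besselKernel N α t * g (x - t))) := h2.sub (h1.const_mul _)
  rw [integral_add h5 (hG.const_mul _), integral_sub h2 (h1.const_mul _),
    integral_const_mul, integral_const_mul, integral_besselKernel hα] at h3
  change 0 ≤ _ - 2 * m * m + m ^ 2 * 1 at h3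
  linarith

theorem memLp_besselKernel_convolution (hα : 0 < α)
    {g : EuclideanSpace ℝ (Fin N) → ℝ} (hg : MemLp g 2 volume) :
    MemLp (besselKernel N α ⋆[mul ℝ ℝ] g) 2 volume := by
  have hm := aestronglyMeasurable_besselKernel_convolution hα hg
  rw [memLp_two_iff_integrable_sq hm]
  have hsq : Integrable (fun x ↦ g x ^ 2) := (memLp_two_iff_integrable_sq hg.1).1 hg
  refine ((integrable_besselKernel hα).integrable_convolution (mul ℝ ℝ) hsq).mono (hm.pow 2) ?_
  filter_upwards [sq_besselKernel_convolution_le hα hg] with x hx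
  rw [Real.norm_of_nonneg (sq_nonneg _)]
  exact hx.trans (le_abs_self _)

/-- The operator `g ↦ G_α * g` on `L²(ℝ^N)`. -/
def besselPotential (N : ℕ) {α : ℝ} (hα : 0 < α) :
    Lp ℝ 2 (volume : Measure (EuclideanSpace ℝ (Fin N))) →ₗ[ℝ]
      Lp ℝ 2 (volume : Measure (EuclideanSpace ℝ (Fin N))) where
  toFun g := (memLp_besselKernel_convolution hα (Lp.memLp g)).toLp _
  map_add' g h := by
    rw [← MemLp.toLp_add, MemLp.toLp_eq_toLp_iff]
    filter_upwards [ae_convolutionExistsAt_besselKernel hα (Lp.memLp g),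
      ae_convolutionExistsAt_besselKernel hα (Lp.memLp h)] with x h1 h2
    rw [Pi.add_apply, convolution_congr (mul ℝ ℝ) EventuallyEq.rfl (Lp.coeFn_add g h)]
    exact ConvolutionExistsAt.distrib_add h1.1 h2.1
  map_smul' r g := by
    rw [RingHom.id_apply, ← MemLp.toLp_const_smul, MemLp.toLp_eq_toLp_iff]
    refine ae_of_all _ fun x ↦ ?_
    rw [convolution_congr (mul ℝ ℝ) EventuallyEq.rfl (Lp.coeFn_smul r g), convolution_smul]

theorem coeFn_besselPotential (hα : 0 < α)
    (g : Lp ℝ 2 (volume : Measure (EuclideanSpace ℝ (Fin N)))) :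
    besselPotential N hα g =ᵐ[volume] besselKernel N α ⋆[mul ℝ ℝ] g :=
  MemLp.coeFn_toLp (memLp_besselKernel_convolution hα (Lp.memLp g))

/-- Every smooth compactly supported function is the convolution of `G_α` with a Schwartz
function. -/
theorem exists_schwartz_besselKernel_convolution (hα : 0 < α)
    {ψ : EuclideanSpace ℝ (Fin N) → ℝ} (hψ : ContDiff ℝ (⊤ : ℕ∞) ψ) (hs : HasCompactSupport ψ) :
    ∃ φ : 𝓢(EuclideanSpace ℝ (Fin N), ℂ), ∀ x,
      ∫ y, (besselKernel N α (x - y) : ℂ) * φ y = (ψ x : ℂ) := by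
  have hs' : HasCompactSupport (fun x ↦ (ψ x : ℂ)) := hs.comp_left (g := Complex.ofReal) rfl
  have hψ' : ContDiff ℝ (⊤ : ℕ∞) (fun x ↦ (ψ x : ℂ)) := Complex.ofRealCLM.contDiff.comp hψ
  let Ψ : 𝓢(EuclideanSpace ℝ (Fin N), ℂ) := hs'.toSchwartzMap hψ'
  have hΨ : ∀ x, Ψ x = (ψ x : ℂ) := fun x ↦ rfl
  let m : EuclideanSpace ℝ (Fin N) → ℂ :=
    fun ξ ↦ (((1 + ‖(2 * Real.pi) • ξ‖ ^ 2) ^ (α / 2) : ℝ) : ℂ)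
  have hm : m.HasTemperateGrowth := by
    have h1 : Function.HasTemperateGrowth
        (fun x : EuclideanSpace ℝ (Fin N) ↦ (((1 + ‖x‖ ^ 2) ^ (α / 2) : ℝ) : ℂ)) := by fun_prop
    exact h1.comp (((2 * Real.pi) • ContinuousLinearMap.id ℝ
      (EuclideanSpace ℝ (Fin N))).hasTemperateGrowth)
  let φ : 𝓢(EuclideanSpace ℝ (Fin N), ℂ) := 𝓕⁻ (SchwartzMap.smulLeftCLM ℂ m (𝓕 Ψ))
  have hGc : Integrable (fun x ↦ (besselKernel N α x : ℂ)) :=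
    (integrable_besselKernel (N := N) hα).ofReal
  let h := (fun x ↦ (besselKernel N α x : ℂ)) ⋆[mul ℂ ℂ] φ
  have hF : 𝓕 h = 𝓕 (Ψ : EuclideanSpace ℝ (Fin N) → ℂ) := by
    ext ξ
    have h1 : 𝓕 (φ : EuclideanSpace ℝ (Fin N) → ℂ) ξ =
        m ξ * 𝓕 (Ψ : EuclideanSpace ℝ (Fin N) → ℂ) ξ := by
      rw [← SchwartzMap.fourier_coe, FourierTransform.fourier_fourierInv_eq,
        SchwartzMap.smulLeftCLM_apply_apply hm, smul_eq_mul, SchwartzMap.fourier_coe]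
    have e7 : (0 : ℝ) < 1 + ‖(2 * Real.pi) • ξ‖ ^ 2 := by positivity
    rw [Real.fourier_mul_convolution_eq hGc φ.integrable, fourier_besselKernel hα, h1, ← mul_assoc,
      ← Complex.ofReal_mul, ← Real.rpow_add e7]
    simp
  have hcont : Continuous h :=
    BddAbove.continuous_convolution_right_of_integrable (mul ℂ ℂ)
      ⟨SchwartzMap.seminorm ℝ 0 0 φ, fun x ⟨y, hy⟩ ↦ hy ▸ SchwartzMap.norm_le_seminorm ℝ φ y⟩
      hGc φ.continuous
  have hint : Integrable h := hGc.integrable_convolution (mul ℂ ℂ) φ.integrable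
  have hFi : Integrable (𝓕 h) := by
    rw [hF, ← SchwartzMap.fourier_coe]; exact (𝓕 Ψ).integrable
  have hΨi : Integrable (𝓕 (Ψ : EuclideanSpace ℝ (Fin N) → ℂ)) := hF ▸ hFi
  have heq : h = Ψ := by
    rw [← hcont.fourierInv_fourier_eq hint hFi, hF,
      Ψ.continuous.fourierInv_fourier_eq Ψ.integrable hΨi]
  refine ⟨φ, fun x ↦ ?_⟩
  rw [← hΨ, ← heq]
  exact (convolution_mul_swap (𝕜 := ℂ) (μ := volume)
    (f := fun x ↦ (besselKernel N α x : ℂ)) (g := φ)).symm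

/-- If `G_α * g = 0` with `g ∈ L²`, then `g = 0`. -/
theorem besselPotential_injective (hα : 0 < α) :
    Function.Injective (besselPotential N hα) := by
  rw [injective_iff_map_eq_zero]
  intro g hg0
  have hconv : besselKernel N α ⋆[mul ℝ ℝ] g =ᵐ[volume] 0 := by
    refine (coeFn_besselPotential hα g).symm.trans ?_
    rw [hg0]
    exact Lp.coeFn_zero _ _ _
  have hg := Lp.memLp g
  have habs : MemLp (fun x ↦ |g x|) 2 (volume : Measure (EuclideanSpace ℝ (Fin N))) := hg.abs
  rw [Lp.eq_zero_iff_ae_eq_zero]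
  refine ae_eq_zero_of_integral_contDiff_smul_eq_zero (hg.locallyIntegrable (by norm_num)) ?_
  intro ψ hψ hs
  obtain ⟨φ, hφ⟩ := exists_schwartz_besselKernel_convolution (N := N) hα hψ hs
  let F : EuclideanSpace ℝ (Fin N) → EuclideanSpace ℝ (Fin N) → ℂ :=
    fun x y ↦ (besselKernel N α (x - y) : ℂ) * φ y * (g x : ℂ)
  have hF : Integrable (Function.uncurry F) (volume.prod volume) := by
    have hFm : AEStronglyMeasurable (Function.uncurry F) (volume.prod volume) := by
      have h1 : AEStronglyMeasurable
          (fun p : EuclideanSpace ℝ (Fin N) × EuclideanSpace ℝ (Fin N) ↦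
            (besselKernel N α (p.1 - p.2) : ℂ)) (volume.prod volume) :=
        Complex.continuous_ofReal.comp_aestronglyMeasurable
          ((integrable_besselKernel hα).aestronglyMeasurable.comp_quasiMeasurePreserving
            (quasiMeasurePreserving_sub volume volume))
      have h2 : AEStronglyMeasurable
          (fun p : EuclideanSpace ℝ (Fin N) × EuclideanSpace ℝ (Fin N) ↦ φ p.2)
            (volume.prod volume) := (φ.continuous.comp continuous_snd).aestronglyMeasurable
      have h3 : AEStronglyMeasurable
          (fun p : EuclideanSpace ℝ (Fin N) × EuclideanSpace ℝ (Fin N) ↦ (g p.1 : ℂ))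
            (volume.prod volume) :=
        Complex.continuous_ofReal.comp_aestronglyMeasurable (hg.1.comp_fst)
      exact (h1.mul h2).mul h3
    rw [integrable_prod_iff' hFm]
    have key : ∀ x y, ‖F x y‖ = ‖φ y‖ * (besselKernel N α (y - x) * |g x|) := by
      intro x y
      have : besselKernel N α (x - y) = besselKernel N α (y - x) := by
        rw [← besselKernel_neg, neg_sub]
      simp [F, this, abs_of_nonneg (besselKernel_nonneg hα (y - x))]
      ring
    constructor
    · filter_upwards [ae_convolutionExistsAt_besselKernel hα habs,
        hFm.prodMk_right] with y hy hmy
      have hy' := (hy.1.comp_sub_left y).const_mul ‖φ y‖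
      simp only [sub_sub_cancel] at hy'
      refine hy'.mono hmy (ae_of_all _ fun x ↦ ?_)
      exact (key x y).le.trans (le_abs_self _)
    · have h1 := memLp_besselKernel_convolution hα habs
      have h2 : MemLp (fun y ↦ ‖φ y‖) 2 (volume : Measure (EuclideanSpace ℝ (Fin N))) :=
        (φ.memLp 2 volume).norm
      refine (h2.integrable_mul h1).congr (ae_of_all _ fun y ↦ ?_)
      simp only [Function.uncurry, key, Pi.mul_apply]
      rw [integral_const_mul]
      congr 1
      exact convolution_mul_swap (𝕜 := ℝ)
  have hC : ∫ x, ((ψ x • g x : ℝ) : ℂ) = 0 := by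
    calc ∫ x, ((ψ x • g x : ℝ) : ℂ) = ∫ x, ∫ y, F x y := by
          refine integral_congr_ae (ae_of_all _ fun x ↦ ?_)
          simp only [F]
          rw [integral_mul_const, hφ x]
          simp
      _ = ∫ y, ∫ x, F x y := integral_integral_swap hF
      _ = ∫ y, (0 : ℂ) := by
          refine integral_congr_ae ?_
          filter_upwards [hconv] with y hy
          have hy' : ∫ x, besselKernel N α (y - x) * g x = 0 :=
            (convolution_mul_swap (𝕜 := ℝ)).symm.trans hy
          have : ∀ x, F x y = φ y * ((besselKernel N α (y - x) * g x : ℝ) : ℂ) := by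
            intro x
            have : besselKernel N α (x - y) = besselKernel N α (y - x) := by
              rw [← besselKernel_neg, neg_sub]
            simp only [F, this]
            push_cast
            ring
          simp_rw [this]
          rw [integral_const_mul, integral_complex_ofReal, hy']
          simp
      _ = 0 := by simp
  rw [integral_complex_ofReal] at hC
  exact_mod_cast hC

/-- The Bessel space `L^{α,2}(ℝ^N) = {G_α * g : g ∈ L²(ℝ^N)}`, as a type of its own since its norm
is not the one of `L²`. -/
def BesselSpace (N : ℕ) {α : ℝ} (hα : 0 < α) : Type :=
  LinearMap.range (besselPotential N hα)

namespace BesselSpace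

instance (hα : 0 < α) : AddCommGroup (BesselSpace N hα) :=
  inferInstanceAs (AddCommGroup (LinearMap.range (besselPotential N hα)))

instance (hα : 0 < α) : Module ℝ (BesselSpace N hα) :=
  inferInstanceAs (Module ℝ (LinearMap.range (besselPotential N hα)))

/-- The underlying function (class) of an element of the Bessel space. -/
def toL2 (hα : 0 < α) :
    BesselSpace N hα →ₗ[ℝ] Lp ℝ 2 (volume : Measure (EuclideanSpace ℝ (Fin N))) :=
  (LinearMap.range (besselPotential N hα)).subtype

/-- The map `G_α * g ↦ g`. -/
def density (hα : 0 < α) :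
    BesselSpace N hα ≃ₗ[ℝ] Lp ℝ 2 (volume : Measure (EuclideanSpace ℝ (Fin N))) :=
  (LinearEquiv.ofInjective _ (besselPotential_injective hα)).symm

/-- The Bessel norm: `‖f‖ = ‖g‖₂` if `f = G_α * g`. -/
instance (hα : 0 < α) : NormedAddCommGroup (BesselSpace N hα) :=
  NormedAddCommGroup.induced _ _ (density hα) (density hα).injective

instance (hα : 0 < α) : NormedSpace ℝ (BesselSpace N hα) :=
  NormedSpace.induced ℝ _ _ (density hα)

theorem norm_eq (hα : 0 < α) (f : BesselSpace N hα) : ‖f‖ = ‖density hα f‖ := rfl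

theorem toL2_ae_eq (hα : 0 < α) (f : BesselSpace N hα) :
    toL2 hα f =ᵐ[volume] besselKernel N α ⋆[mul ℝ ℝ] density hα f := by
  refine EventuallyEq.trans ?_ (coeFn_besselPotential hα (density hα f))
  have h : besselPotential N hα (density hα f) = toL2 hα f :=
    congrArg Subtype.val
      ((LinearEquiv.ofInjective _ (besselPotential_injective hα)).apply_symm_apply f)
  rw [h]

end BesselSpace

end

/-- The compactness condition (K): the integrals of `c` over `A n \ B(0, r)` tend to `0` as
`r → ∞`, uniformly in `n`, for every sequence of Borel sets of uniformly bounded measure. -/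
def CompactnessConditionK {N : ℕ} (c : EuclideanSpace ℝ (Fin N) → ℝ) : Prop :=
  ∀ A : ℕ → Set (EuclideanSpace ℝ (Fin N)), (∀ n, MeasurableSet (A n)) →
    (⨆ n, volume (A n)) < ⊤ →
    TendstoUniformly (fun (r : ℝ) (n : ℕ) ↦ ∫ x in A n ∩ (Metric.ball 0 r)ᶜ, c x)
      (fun _ ↦ 0) atTop

/-- The weighted measure `c dx`. -/
def weightedMeasure {N : ℕ} (c : EuclideanSpace ℝ (Fin N) → ℝ) :
    Measure (EuclideanSpace ℝ (Fin N)) :=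
  volume.withDensity fun x ↦ ENNReal.ofReal (c x)

end

/-! The inclusion is a limit, in operator norm, of compact operators, and the compact operators form
a closed set. Write u = G_α * g and let B be a large ball about 0.

Outside B, u is small in L^q(c dx), uniformly over the unit sphere. Where |u| ≤ δ, |u|^q is at most
δ^(q-2)|u|^2; where |u| > M, it is at most M^(q-p)|u|^p, with q < p < 2N/(N-2α). The remaining
values occur in {|u| > δ}, whose Lebesgue measure is at most a constant over δ^2, so condition (K)
makes its c-mass outside B small (`BesselSpace.exists_eLpNorm_indicator_compl_ball_le`).

Inside B, subcriticality of q puts G_α in L^r with 1/r = 1/2 + 1/q (`memLp_besselKernel`). Replacing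
G_α by a continuous compactly supported K close to it in L^r costs little, by Young's inequality
(`eLpNorm_convolution_le_of_two_le`) and the boundedness of c. The map x ↦ K(x - ·) is bounded and
continuous with values in L^2, hence Bochner L^q over B; approximating it by simple functions
exhibits g ↦ 1_B (K * g) as a limit of finite-rank operators (`isCompactOperator_inner_compLpL₂`).

Injectivity needs only c > 0: null sets of c dx are then Lebesgue null. -/

noncomputable section

open scoped ENNReal
open ContinuousLinearMap (mul)

/-! ### Young's inequality and the integrability of the Bessel kernel -/

/-- Young's convolution inequality `‖K * g‖_q ≤ ‖K‖_r ‖g‖_2` with `1 / r = 1 / 2 + 1 / q`. -/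
theorem eLpNorm_convolution_le_of_two_le {N : ℕ} {K g : EuclideanSpace ℝ (Fin N) → ℝ} {q : ℝ}
    (hq : 2 ≤ q) (hK : AEStronglyMeasurable K volume) (hg : AEStronglyMeasurable g volume) :
    eLpNorm (K ⋆[mul ℝ ℝ] g) (ENNReal.ofReal q) volume ≤
      eLpNorm K (ENNReal.ofReal (2 * q / (q + 2))) volume * eLpNorm g 2 volume := by
  set r : ℝ := 2 * q / (q + 2) with hr
  have hq0 : 0 < q := by linarith
  have hr0 : 0 < r := by positivity
  set k : EuclideanSpace ℝ (Fin N) → ℝ≥0∞ := fun x ↦ ‖K x‖ₑ ^ r with hk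
  set h : EuclideanSpace ℝ (Fin N) → ℝ≥0∞ := fun x ↦ ‖g x‖ₑ ^ (2 : ℝ) with hh
  have hkm : AEMeasurable k volume := hK.enorm.pow_const r
  have hhm : AEMeasurable h volume := hg.enorm.pow_const 2
  have hsub : ∀ x, AEMeasurable (fun t ↦ h (x - t)) volume := fun x ↦
    hhm.comp_quasiMeasurePreserving (quasiMeasurePreserving_sub_left volume x)
  have hprod : AEMeasurable (fun p : EuclideanSpace ℝ (Fin N) × EuclideanSpace ℝ (Fin N) ↦
      k p.2 * h (p.1 - p.2)) (volume.prod volume) :=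
    hkm.comp_snd.mul
      (hhm.comp_quasiMeasurePreserving (quasiMeasurePreserving_sub volume volume))
  have hp3 : 0 ≤ 1 / 2 - 1 / q := by
    rw [sub_nonneg]; exact one_div_le_one_div_of_le two_pos hq
  have hpt : ∀ x, ‖(K ⋆[mul ℝ ℝ] g) x‖ₑ ^ q ≤
      (∫⁻ t, k t * h (x - t)) * ((∫⁻ t, k t) ^ (q / 2) * (∫⁻ t, h t) ^ (q / 2 - 1)) := by
    intro x
    have e1 : ‖(K ⋆[mul ℝ ℝ] g) x‖ₑ ≤ ∫⁻ t, ‖K t‖ₑ * ‖g (x - t)‖ₑ := by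
      refine (enorm_integral_le_lintegral_enorm _).trans_eq ?_
      simp [enorm_mul]
    -- Hölder with three factors, of weights 1/q, 1/2 and 1/2 - 1/q. The power of |K| recombines to
    -- 1 because r(1/q + 1/2) = 1. Only the first factor still depends on x after integration in t.
    have e2 : ∀ t, ‖K t‖ₑ * ‖g (x - t)‖ₑ =
        ∏ i : Fin 3, (![fun t ↦ k t * h (x - t), k, fun t ↦ h (x - t)] i t) ^
          (![1 / q, 1 / 2, 1 / 2 - 1 / q] i) := by
      intro t
      simp only [Fin.prod_univ_three, Matrix.cons_val_zero, Matrix.cons_val_one, Matrix.cons_val,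
        hk, hh]
      rw [ENNReal.mul_rpow_of_nonneg _ _ (by positivity), ← ENNReal.rpow_mul, ← ENNReal.rpow_mul,
        ← ENNReal.rpow_mul, ← ENNReal.rpow_mul]
      have a1 : ‖K t‖ₑ = ‖K t‖ₑ ^ (r * (1 / q)) * ‖K t‖ₑ ^ (r * (1 / 2)) := by
        rw [← ENNReal.rpow_add_of_nonneg _ _ (by positivity) (by positivity)]
        conv_lhs => rw [← ENNReal.rpow_one ‖K t‖ₑ]
        congr 1
        rw [hr]; field_simp; ring
      have a2 : ‖g (x - t)‖ₑ = ‖g (x - t)‖ₑ ^ (2 * (1 / q)) *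
          ‖g (x - t)‖ₑ ^ (2 * (1 / 2 - 1 / q)) := by
        rw [← ENNReal.rpow_add_of_nonneg _ _ (by positivity) (by positivity)]
        conv_lhs => rw [← ENNReal.rpow_one ‖g (x - t)‖ₑ]
        congr 1
        ring
      conv_lhs => rw [a1, a2]
      ring
    have e3 := ENNReal.lintegral_prod_norm_pow_le (μ := (volume : Measure (EuclideanSpace ℝ (Fin N))))
      Finset.univ (f := ![fun t ↦ k t * h (x - t), k, fun t ↦ h (x - t)])
      (by
        intro i _
        fin_cases i
        · exact hkm.mul (hsub x)
        · exact hkm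
        · exact hsub x)
      (p := ![1 / q, 1 / 2, 1 / 2 - 1 / q]) (by simp [Fin.sum_univ_three]; ring)
      (by
        intro i _
        fin_cases i
        · simpa using hq0.le
        · simp
        · simpa using hp3)
    simp_rw [← e2] at e3
    simp only [Fin.prod_univ_three, Matrix.cons_val_zero, Matrix.cons_val_one, Matrix.cons_val]
      at e3
    rw [lintegral_sub_left_eq_self h x] at e3
    calc ‖(K ⋆[mul ℝ ℝ] g) x‖ₑ ^ q ≤ _ := ENNReal.rpow_le_rpow (e1.trans e3) hq0.le
      _ = _ := by
        rw [ENNReal.mul_rpow_of_nonneg _ _ hq0.le, ENNReal.mul_rpow_of_nonneg _ _ hq0.le,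
          ← ENNReal.rpow_mul, ← ENNReal.rpow_mul, ← ENNReal.rpow_mul, mul_assoc]
        congr 2
        · rw [one_div_mul_cancel hq0.ne', ENNReal.rpow_one]
        · congr 1; ring
        · congr 1; field_simp
  have hdouble : ∫⁻ x, ∫⁻ t, k t * h (x - t) = (∫⁻ t, k t) * ∫⁻ t, h t := by
    rw [lintegral_lintegral_swap hprod]
    have : ∀ t, ∫⁻ x, k t * h (x - t) = k t * ∫⁻ y, h y := by
      intro t
      have hm : AEMeasurable (fun x ↦ h (x - t)) volume := hhm.comp_quasiMeasurePreserving
        (measurePreserving_sub_right volume t).quasiMeasurePreserving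
      rw [lintegral_const_mul'' _ hm, lintegral_sub_right_eq_self h t]
    simp_rw [this]
    rw [lintegral_mul_const'' _ hkm]
  have hmain : ∫⁻ x, ‖(K ⋆[mul ℝ ℝ] g) x‖ₑ ^ q ≤
      (∫⁻ t, k t) ^ (q / 2 + 1) * (∫⁻ t, h t) ^ (q / 2) := by
    calc _ ≤ ∫⁻ x, (∫⁻ t, k t * h (x - t)) *
            ((∫⁻ t, k t) ^ (q / 2) * (∫⁻ t, h t) ^ (q / 2 - 1)) := lintegral_mono hpt
      _ = (∫⁻ x, ∫⁻ t, k t * h (x - t)) *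
            ((∫⁻ t, k t) ^ (q / 2) * (∫⁻ t, h t) ^ (q / 2 - 1)) :=
          lintegral_mul_const'' _ hprod.lintegral_prod_right'
      _ = _ := by
        rw [hdouble, ENNReal.rpow_add_of_nonneg _ _ (by positivity) zero_le_one, ENNReal.rpow_one]
        have : (∫⁻ t, h t) ^ (q / 2) = (∫⁻ t, h t) ^ (q / 2 - 1) * ∫⁻ t, h t := by
          conv_rhs => enter [2]; rw [← ENNReal.rpow_one (∫⁻ t, h t)]
          rw [← ENNReal.rpow_add_of_nonneg _ _ (by linarith) zero_le_one]
          congr 1; ring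
        rw [this]
        ring
  rw [eLpNorm_eq_lintegral_rpow_enorm_toReal (by simpa using hq0) ENNReal.ofReal_ne_top,
    eLpNorm_eq_lintegral_rpow_enorm_toReal (by simpa using hr0) ENNReal.ofReal_ne_top,
    eLpNorm_eq_lintegral_rpow_enorm_toReal (by simp) (by simp),
    ENNReal.toReal_ofReal hq0.le, ENNReal.toReal_ofReal hr0.le, ENNReal.toReal_ofNat]
  refine (ENNReal.rpow_le_rpow hmain (by positivity)).trans_eq ?_
  rw [ENNReal.mul_rpow_of_nonneg _ _ (by positivity), ← ENNReal.rpow_mul, ← ENNReal.rpow_mul]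
  congr 2
  · rw [hr]; field_simp
  · field_simp

/-- The Bessel kernel `G_α` lies in `L^r` whenever `(N - α) r < N`. -/
theorem memLp_besselKernel {N : ℕ} {α r : ℝ} (hα : 0 < α) (hr : 1 ≤ r)
    (hrN : (N - α) * r < N) : MemLp (besselKernel N α) (ENNReal.ofReal r) volume := by
  have hr0 : 0 < r := by linarith
  refine ⟨(integrable_besselKernel hα).1, ?_⟩
  rw [eLpNorm_lt_top_iff_lintegral_rpow_enorm_lt_top (by simpa using hr0) ENNReal.ofReal_ne_top,
    ENNReal.toReal_ofReal hr0.le]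
  -- The integrand of order α is dominated by the integrand of order β to the power 1/r times m to
  -- the power 1 - 1/r. The value of β is forced by matching powers of t. Both m and the order-β
  -- integrand must be integrable, so γ and β must be positive; this γ gives β = 2(r + 1)γ. Hölder
  -- in t then bounds G_α^r by a multiple of the t-integral of order β, which is integrable in x.
  set γ : ℝ := (N - (N - α) * r) / (4 * r) with hγ
  have hγ0 : 0 < γ := by
    have : 0 < N - (N - α) * r := by linarith
    positivity
  set β : ℝ := N - (N - α) * r - 2 * (r - 1) * γ with hβ
  have hβ0 : 0 < β := by
    have h1 : N - (N - α) * r = 4 * r * γ := by rw [hγ]; field_simp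
    rw [hβ, h1]; nlinarith
  set m : ℝ → ℝ := fun t ↦ t ^ (γ - 1) * Real.exp (-(1 / (4 * Real.pi) * t)) with hm
  have hmi : Integrable m (volume.restrict (Set.Ioi 0)) := by
    apply Integrable.of_integral_ne_zero
    rw [Real.integral_rpow_mul_exp_neg_mul_Ioi hγ0 (by positivity)]
    have := Real.Gamma_pos_of_pos hγ0
    positivity
  have hr1 : 0 ≤ 1 - 1 / r := by
    rw [sub_nonneg, div_le_one hr0]; exact hr
  have hpt : ∀ x : EuclideanSpace ℝ (Fin N), ∀ t ∈ Set.Ioi (0 : ℝ),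
      ‖besselIntegrand N α x t‖ₑ ≤ ‖besselIntegrand N β x t‖ₑ ^ (1 / r) * ‖m t‖ₑ ^ (1 - 1 / r) := by
    intro x t ht
    have ht' : 0 < t := ht
    have hm0 : 0 ≤ m t := by simp only [hm]; positivity
    have hb0 := besselIntegrand_nonneg (N := N) (α := β) x ht'
    rw [← Real.enorm_rpow_of_nonneg hb0 (by positivity), ← Real.enorm_rpow_of_nonneg hm0 hr1,
      ← enorm_mul]
    rw [Real.enorm_of_nonneg (besselIntegrand_nonneg x ht'), Real.enorm_of_nonneg (by positivity)]
    apply ENNReal.ofReal_le_ofReal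
    simp only [besselIntegrand, hm]
    have p1 := Real.exp_pos (-(Real.pi / t) * ‖x‖ ^ 2)
    have p2 := Real.exp_pos (-(t / (4 * Real.pi)))
    rw [Real.mul_rpow (by positivity) (by positivity), Real.mul_rpow p1.le p2.le,
      Real.mul_rpow (by positivity) (by positivity), ← Real.exp_mul, ← Real.exp_mul, ← Real.exp_mul,
      ← Real.rpow_mul ht'.le, ← Real.rpow_mul ht'.le]
    have e1 : t ^ ((α - N) / 2 - 1) =
        t ^ (((β - N) / 2 - 1) * (1 / r)) * t ^ ((γ - 1) * (1 - 1 / r)) := by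
      rw [← Real.rpow_add ht']
      congr 1
      rw [hβ]; field_simp; ring
    have e2 : Real.exp (-(t / (4 * Real.pi))) = Real.exp (-(t / (4 * Real.pi)) * (1 / r)) *
        Real.exp (-(1 / (4 * Real.pi) * t) * (1 - 1 / r)) := by
      rw [← Real.exp_add]; congr 1; ring
    -- The only loss: m carries no Gaussian in x, and weakening the Gaussian is allowed since r ≥ 1.
    have e3 : Real.exp (-(Real.pi / t) * ‖x‖ ^ 2) ≤
        Real.exp (-(Real.pi / t) * ‖x‖ ^ 2 * (1 / r)) := by
      apply Real.exp_le_exp.2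
      have : 0 ≤ Real.pi / t * ‖x‖ ^ 2 := by positivity
      nlinarith
    rw [e1, e2]
    calc _ ≤ Real.exp (-(Real.pi / t) * ‖x‖ ^ 2 * (1 / r)) *
          (Real.exp (-(t / (4 * Real.pi)) * (1 / r)) *
            Real.exp (-(1 / (4 * Real.pi) * t) * (1 - 1 / r))) *
          (t ^ (((β - N) / 2 - 1) * (1 / r)) * t ^ ((γ - 1) * (1 - 1 / r))) := by gcongr
      _ = _ := by ring
  have hbm : Measurable (Function.uncurry fun (x : EuclideanSpace ℝ (Fin N)) t ↦
      ‖besselIntegrand N β x t‖ₑ) := measurable_besselIntegrand.enorm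
  have hG : ∀ x : EuclideanSpace ℝ (Fin N), ‖besselKernel N α x‖ₑ ^ r ≤
      (‖1 / ((4 * Real.pi) ^ (α / 2) * Real.Gamma (α / 2))‖ₑ ^ r *
        (∫⁻ t in Set.Ioi 0, ‖m t‖ₑ) ^ (r - 1)) *
        ∫⁻ t in Set.Ioi 0, ‖besselIntegrand N β x t‖ₑ := by
    intro x
    have h1 : ∫⁻ t in Set.Ioi 0, ‖besselIntegrand N α x t‖ₑ ≤
        (∫⁻ t in Set.Ioi 0, ‖besselIntegrand N β x t‖ₑ) ^ (1 / r) *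
          (∫⁻ t in Set.Ioi 0, ‖m t‖ₑ) ^ (1 - 1 / r) :=
      (setLIntegral_mono' measurableSet_Ioi (hpt x)).trans
        (ENNReal.lintegral_mul_norm_pow_le (hbm.comp measurable_prodMk_left).aemeasurable
          hmi.1.enorm (by positivity) hr1 (by ring))
    unfold besselKernel
    rw [enorm_mul, ENNReal.mul_rpow_of_nonneg _ _ hr0.le, mul_assoc]
    gcongr
    calc _ ≤ ((∫⁻ t in Set.Ioi 0, ‖besselIntegrand N β x t‖ₑ) ^ (1 / r) *
          (∫⁻ t in Set.Ioi 0, ‖m t‖ₑ) ^ (1 - 1 / r)) ^ r :=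
          ENNReal.rpow_le_rpow ((enorm_integral_le_lintegral_enorm _).trans h1) hr0.le
      _ = _ := by
        rw [ENNReal.mul_rpow_of_nonneg _ _ hr0.le, ← ENNReal.rpow_mul, ← ENNReal.rpow_mul,
          one_div_mul_cancel hr0.ne', ENNReal.rpow_one, mul_comm]
        congr 2
        field_simp
  refine (lintegral_mono hG).trans_lt ?_
  rw [lintegral_const_mul _ hbm.lintegral_prod_right]
  refine ENNReal.mul_lt_top (ENNReal.mul_lt_top ?_ ?_) ?_
  · exact ENNReal.rpow_lt_top_of_nonneg hr0.le enorm_ne_top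
  · exact ENNReal.rpow_lt_top_of_nonneg (by linarith) hmi.2.ne
  · have := (integrable_uncurry_besselIntegrand (N := N) hβ0).2
    rwa [HasFiniteIntegral, lintegral_prod _ measurable_besselIntegrand.enorm.aemeasurable] at this

/-! ### Compactness of localised convolution operators -/

/-- A Bochner `L^p` function `φ` with values in a Hilbert space `H` defines a compact operator
`g ↦ ⟪φ, g⟫` from `H` to `L^p`. -/
theorem isCompactOperator_inner_compLpL₂ {X H : Type*} [MeasurableSpace X] {μ : Measure X}
    [NormedAddCommGroup H] [InnerProductSpace ℝ H] {p : ℝ≥0∞} [Fact (1 ≤ p)] (hp : p ≠ ⊤)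
    (φ : Lp H p μ) :
    IsCompactOperator (((innerSL ℝ (E := H)).compLpL₂ p μ).flip φ) := by
  -- An indicator times a vector gives an operator of rank at most one. Sums preserve compactness,
  -- and limits do too because the operator depends continuously on φ.
  induction φ using Lp.induction hp with
  | @indicatorConst c s hs hμs =>
    have h : (((innerSL ℝ (E := H)).compLpL₂ p μ).flip
        (Lp.simpleFunc.indicatorConst p hs hμs.ne c : Lp H p μ)) =
        (((ContinuousLinearMap.lsmul ℝ ℝ).flip
          (indicatorConstLp p hs hμs.ne (1 : ℝ))).comp (innerSL ℝ c)) := by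
      ext1 g
      apply Lp.ext
      rw [Lp.simpleFunc.coe_indicatorConst]
      simp only [ContinuousLinearMap.flip_apply, ContinuousLinearMap.compLpL₂_apply_apply,
        ContinuousLinearMap.comp_apply, ContinuousLinearMap.lsmul_apply, innerSL_apply_apply]
      filter_upwards [(innerSL ℝ g).coeFn_compLp (indicatorConstLp p hs hμs.ne c),
        Lp.coeFn_smul (inner ℝ c g) (indicatorConstLp p hs hμs.ne (1 : ℝ)),
        indicatorConstLp_coeFn (p := p) (hs := hs) (hμs := hμs.ne) (c := c),
        indicatorConstLp_coeFn (p := p) (hs := hs) (hμs := hμs.ne) (c := (1 : ℝ))]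
        with x h1 h2 h3 h4
      rw [h1, h2, h3, Pi.smul_apply, h4]
      by_cases hx : x ∈ s <;> simp [hx, real_inner_comm]
    rw [h]
    exact (isCompactOperator_of_locallyCompactSpace_rng
      ((ContinuousLinearMap.lsmul ℝ ℝ).flip (indicatorConstLp p hs hμs.ne (1 : ℝ)))).comp_clm _
  | add hf hg _ h2 h3 =>
    rw [map_add]
    exact h2.add h3
  | isClosed =>
    exact isClosed_setOfPred_isCompactOperator.preimage
      ((innerSL ℝ (E := H)).compLpL₂ p μ).flip.continuous

/-- Convolution with an `L²` kernel, cut off to a set of finite measure, is a compact operator from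
`L²` to `L^p`. -/
theorem exists_isCompactOperator_indicator_convolution {N : ℕ}
    {μ : Measure (EuclideanSpace ℝ (Fin N))} {p : ℝ≥0∞} [Fact (1 ≤ p)] (hp : p ≠ ⊤)
    {K : EuclideanSpace ℝ (Fin N) → ℝ} (hK : MemLp K 2 volume)
    {B : Set (EuclideanSpace ℝ (Fin N))} (hB : MeasurableSet B) (hμB : μ B ≠ ⊤) :
    ∃ S : Lp ℝ 2 (volume : Measure (EuclideanSpace ℝ (Fin N))) →L[ℝ] Lp ℝ p μ,
      IsCompactOperator S ∧ ∀ g, S g =ᵐ[μ] B.indicator (K ⋆[mul ℝ ℝ] g) := by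
  have hK' : MemLp (fun y ↦ K (-y)) 2 volume :=
    hK.comp_measurePreserving (Measure.measurePreserving_neg volume)
  -- φ x represents y ↦ K(x - y), obtained by translating the reflected kernel by -x. All these
  -- translates have the same L² norm, so φ is bounded, hence in L^p over a set of finite measure.
  let φ : EuclideanSpace ℝ (Fin N) → Lp ℝ 2 (volume : Measure (EuclideanSpace ℝ (Fin N))) :=
    fun x ↦ DomAddAct.mk (-x) +ᵥ hK'.toLp
  have hφc : Continuous φ := by
    have : Fact ((2 : ℝ≥0∞) ≠ ⊤) := ⟨by simp⟩
    have : Continuous (fun x : EuclideanSpace ℝ (Fin N) ↦ DomAddAct.mk (-x)) :=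
      DomAddAct.continuous_mk.comp continuous_neg
    exact this.vadd continuous_const
  have hφn : ∀ x, ‖φ x‖ = ‖hK'.toLp‖ := fun x ↦ DomAddAct.norm_vadd_Lp _ _
  have hφi : ∀ (g : Lp ℝ 2 (volume : Measure (EuclideanSpace ℝ (Fin N)))) x,
      inner ℝ g (φ x) = (K ⋆[mul ℝ ℝ] g) x := by
    intro g x
    rw [L2.inner_def, convolution_mul_swap (𝕜 := ℝ)]
    apply integral_congr_ae
    have h1 : φ x =ᵐ[volume] fun y ↦ K (x - y) := by
      have := DomAddAct.vadd_Lp_ae_eq (DomAddAct.mk (-x)) hK'.toLp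
      refine this.trans ?_
      have h2 := (quasiMeasurePreserving_add_left volume (-x)).ae_eq_comp hK'.coeFn_toLp
      refine EventuallyEq.trans h2 (ae_of_all _ fun y ↦ ?_)
      simp [sub_eq_add_neg, add_comm]
    filter_upwards [h1] with y hy
    rw [hy]
    simp
  have hφL : MemLp (B.indicator φ) p μ := by
    rw [memLp_indicator_iff_restrict hB]
    have : IsFiniteMeasure (μ.restrict B) := ⟨by simpa using hμB.lt_top⟩
    exact MemLp.of_bound hφc.aestronglyMeasurable _ (ae_of_all _ fun x ↦ (hφn x).le)
  refine ⟨_, isCompactOperator_inner_compLpL₂ hp hφL.toLp, fun g ↦ ?_⟩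
  rw [ContinuousLinearMap.flip_apply, ContinuousLinearMap.compLpL₂_apply_apply]
  filter_upwards [(innerSL ℝ g).coeFn_compLp hφL.toLp, hφL.coeFn_toLp] with x hx1 hx2
  rw [hx1, hx2]
  by_cases hxB : x ∈ B <;> simp [hxB, hφi]

/-! ### Comparison of c dx with Lebesgue measure -/

theorem weightedMeasure_le_smul {N : ℕ} (c : EuclideanSpace ℝ (Fin N) → ℝ) :
    weightedMeasure c ≤ eLpNorm c ⊤ volume • volume := by
  rw [← withDensity_const]
  refine withDensity_mono ?_
  filter_upwards [ae_le_eLpNormEssSup (f := c)] with x hx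
  rw [eLpNorm_exponent_top]
  exact (Real.ofReal_le_enorm _).trans hx

theorem absolutelyContinuous_weightedMeasure {N : ℕ} {c : EuclideanSpace ℝ (Fin N) → ℝ}
    (hc : AEStronglyMeasurable c volume) (hpos : ∀ x, 0 < c x) :
    volume ≪ weightedMeasure c :=
  withDensity_absolutelyContinuous' hc.aemeasurable.ennreal_ofReal
    (ae_of_all _ fun x ↦ by simpa using hpos x)

theorem weightedMeasure_absolutelyContinuous {N : ℕ} (c : EuclideanSpace ℝ (Fin N) → ℝ) :
    weightedMeasure c ≪ volume := withDensity_absolutelyContinuous _ _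

theorem eLpNorm_weightedMeasure_le {N : ℕ} (c f : EuclideanSpace ℝ (Fin N) → ℝ) {p : ℝ≥0∞}
    (hp : p ≠ ⊤) :
    eLpNorm f p (weightedMeasure c) ≤
      eLpNorm c ⊤ volume ^ (1 / p).toReal * eLpNorm f p volume := by
  refine (eLpNorm_mono_measure f (weightedMeasure_le_smul c)).trans_eq ?_
  rw [eLpNorm_smul_measure_of_ne_top hp, smul_eq_mul]

/-! ### The subcritical embedding -/

/-- With Young's exponent r = 2q/(q + 2), the bound r ≥ 1 amounts to q ≥ 2, and the kernel condition
(N - α) r < N amounts to q(N - 2α) < 2N, that is, to subcriticality. -/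
theorem two_mul_div_add_two {N : ℕ} {α q : ℝ} (hN : 2 * α < N) (hq : 2 ≤ q)
    (hq' : q < 2 * N / (N - 2 * α)) :
    1 ≤ 2 * q / (q + 2) ∧ (N - α) * (2 * q / (q + 2)) < N := by
  rw [lt_div_iff₀ (by linarith)] at hq'
  constructor
  · rw [le_div_iff₀ (by linarith)]; linarith
  · rw [← mul_div_assoc, div_lt_iff₀ (by linarith)]; linarith

/-- The subcritical Sobolev embedding of the Bessel space into `L^q`. -/
theorem BesselSpace.exists_eLpNorm_toL2_le {N : ℕ} {α q : ℝ} (hα : 0 < α) (hN : 2 * α < N)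
    (hq : 2 ≤ q) (hq' : q < 2 * N / (N - 2 * α)) :
    ∃ C : ℝ≥0∞, C ≠ ⊤ ∧ ∀ u : BesselSpace N hα,
      eLpNorm (BesselSpace.toL2 hα u) (ENNReal.ofReal q) volume ≤ C * ‖u‖ₑ := by
  obtain ⟨hr, hrN⟩ := two_mul_div_add_two hN hq hq'
  -- The embedding constant is the L^r norm of G_α.
  refine ⟨_, (memLp_besselKernel hα hr hrN).2.ne, fun u ↦ ?_⟩
  rw [eLpNorm_congr_ae (BesselSpace.toL2_ae_eq hα u)]
  refine (eLpNorm_convolution_le_of_two_le hq (integrable_besselKernel hα).1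
    (Lp.aestronglyMeasurable _)).trans_eq ?_
  rw [← Lp.enorm_def]
  rfl

/-! ### Uniformly small tails from condition (K) -/

/-- Small values are absorbed by the square and large values by the p-th power, since 2 < q < p. The
last term handles intermediate values and lives on {a > δ}, the set to which (K) will be applied. -/
theorem rpow_le_add_add_of_lt_of_lt {a δ M q p : ℝ} (ha : 0 ≤ a) (hδ : 0 < δ) (hM : 0 < M)
    (hq : 2 < q) (hp : q < p) :
    a ^ q ≤ δ ^ (q - 2) * a ^ (2 : ℝ) + M ^ (q - p) * a ^ p + if δ < a then M ^ q else 0 := by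
  rcases le_or_gt a δ with h | h
  · have : a ^ q = a ^ (q - 2) * a ^ (2 : ℝ) := by
      rw [← Real.rpow_add' ha (by linarith)]; congr 1; ring
    have h1 : a ^ (q - 2) ≤ δ ^ (q - 2) := Real.rpow_le_rpow ha h (by linarith)
    rw [this, if_neg h.not_gt, add_zero]
    exact (mul_le_mul_of_nonneg_right h1 (by positivity)).trans
      (le_add_of_nonneg_right (by positivity))
  · have ha' : 0 < a := hδ.trans h
    rw [if_pos h]
    rcases le_or_gt a M with h2 | h2
    · exact (Real.rpow_le_rpow ha h2 (by linarith)).trans (le_add_of_nonneg_left (by positivity))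
    · have : a ^ q = a ^ (q - p) * a ^ p := by
        rw [← Real.rpow_add ha']; congr 1; ring
      have h1 : a ^ (q - p) ≤ M ^ (q - p) :=
        Real.rpow_le_rpow_of_nonpos hM h2.le (by linarith)
      have h3 := mul_le_mul_of_nonneg_right h1 (a := a ^ p) (by positivity)
      have : 0 ≤ δ ^ (q - 2) * a ^ (2 : ℝ) := by positivity
      have : 0 ≤ M ^ q := by positivity
      linarith

/-- The exponent may have either sign: a positive one yields the small threshold δ, a negative one
the large threshold M. -/
theorem exists_rpow_mul_le {A s η : ℝ} (hA : 0 ≤ A) (hs : s ≠ 0) (hη : 0 < η) :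
    ∃ δ : ℝ, 0 < δ ∧ δ ^ s * A ≤ η := by
  refine ⟨(η / (A + 1)) ^ s⁻¹, by positivity, ?_⟩
  rw [Real.rpow_inv_rpow (by positivity) hs, div_mul_eq_mul_div, div_le_iff₀ (by positivity)]
  nlinarith

theorem lintegral_rpow_enorm_le_of_eLpNorm_le {X : Type*} [MeasurableSpace X] {μ : Measure X}
    {f : X → ℝ} {p : ℝ} (hp : 0 < p) {C : ℝ≥0∞} (h : eLpNorm f (ENNReal.ofReal p) μ ≤ C) :
    ∫⁻ x, ‖f x‖ₑ ^ p ∂μ ≤ C ^ p := by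
  rw [eLpNorm_eq_lintegral_rpow_enorm_toReal (by simpa using hp) ENNReal.ofReal_ne_top,
    ENNReal.toReal_ofReal hp.le] at h
  have := ENNReal.rpow_le_rpow h hp.le
  rwa [← ENNReal.rpow_mul, one_div_mul_cancel hp.ne', ENNReal.rpow_one] at this

/-- Under condition (K), bounded subsets of the Bessel space have uniformly small tails in
`L^q(c dx)`. -/
theorem BesselSpace.exists_eLpNorm_indicator_compl_ball_le {N : ℕ} {α q : ℝ} (hα : 0 < α)
    (hN : 2 * α < N) {c : EuclideanSpace ℝ (Fin N) → ℝ} (hc : MemLp c ⊤ volume)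
    (hpos : ∀ x, 0 < c x) (hK : CompactnessConditionK c)
    (hq : 2 < q) (hq' : q < 2 * N / (N - 2 * α)) {ε : ℝ} (hε : 0 < ε) :
    ∃ R : ℝ, ∀ u : BesselSpace N hα, ‖u‖ = 1 →
      eLpNorm ((Metric.ball 0 R)ᶜ.indicator (BesselSpace.toL2 hα u)) (ENNReal.ofReal q)
        (weightedMeasure c) ≤ ENNReal.ofReal ε := by
  have hq0 : 0 < q := by linarith
  obtain ⟨p, hqp, hp'⟩ := exists_between hq'
  have hp0 : 0 < p := by linarith
  -- The Lebesgue bound serves for Chebyshev's inequality, the weighted one for the final estimate;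
  -- the factor 1 + D covers both.
  have hbound : ∀ s : ℝ, 2 ≤ s → s < 2 * N / (N - 2 * α) → ∃ A : ℝ, 0 ≤ A ∧
      ∀ u : BesselSpace N hα, ‖u‖ = 1 →
        ∫⁻ x, ‖BesselSpace.toL2 hα u x‖ₑ ^ s ∂volume ≤ ENNReal.ofReal A ∧
        ∫⁻ x, ‖BesselSpace.toL2 hα u x‖ₑ ^ s ∂(weightedMeasure c) ≤ ENNReal.ofReal A := by
    intro s hs hs'
    obtain ⟨C, hC, hu⟩ := exists_eLpNorm_toL2_le hα hN hs hs'
    set D := eLpNorm c ⊤ volume ^ (1 / ENNReal.ofReal s).toReal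
    have hD' : D ≠ ⊤ := ENNReal.rpow_ne_top_of_nonneg (by positivity) hc.2.ne
    have hfin : ((1 + D) * C) ^ s ≠ ⊤ :=
      ENNReal.rpow_ne_top_of_nonneg (by linarith)
        (ENNReal.mul_ne_top (ENNReal.add_ne_top.2 ⟨ENNReal.one_ne_top, hD'⟩) hC)
    refine ⟨(((1 + D) * C) ^ s).toReal, ENNReal.toReal_nonneg, fun u hu1 ↦ ?_⟩
    rw [ENNReal.ofReal_toReal hfin]
    have h1 := hu u
    rw [← ofReal_norm, hu1, ENNReal.ofReal_one, mul_one] at h1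
    constructor
    · refine lintegral_rpow_enorm_le_of_eLpNorm_le (by linarith) (h1.trans ?_)
      rw [add_mul, one_mul]
      exact le_self_add
    · refine lintegral_rpow_enorm_le_of_eLpNorm_le (by linarith)
        ((eLpNorm_weightedMeasure_le c _ ENNReal.ofReal_ne_top).trans ?_)
      exact mul_le_mul' le_add_self h1
  obtain ⟨A₂, hA₂, hu₂⟩ := hbound 2 le_rfl (hq.trans hq')
  obtain ⟨Aₚ, hAₚ, huₚ⟩ := hbound p (by linarith) hp'
  set η : ℝ := ε ^ q / 3 with hη
  have hη0 : 0 < η := by positivity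
  obtain ⟨δ, hδ, hδA⟩ := exists_rpow_mul_le hA₂ (s := q - 2) (by linarith) hη0
  obtain ⟨M, hM, hMA⟩ := exists_rpow_mul_le hAₚ (s := q - p) (by linarith) hη0
  -- Condition (K) speaks of sequences, so a common radius is found by contradiction: u n violates
  -- the bound for the ball of radius n.
  by_contra! hcon
  choose u hu1 hubad using fun n : ℕ ↦ hcon n
  set A : ℕ → Set (EuclideanSpace ℝ (Fin N)) := fun n ↦ {x | δ < ‖BesselSpace.toL2 hα (u n) x‖}
    with hA
  have hmeas : ∀ n, Measurable (BesselSpace.toL2 hα (u n)) := fun n ↦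
    (Lp.stronglyMeasurable (BesselSpace.toL2 hα (u n))).measurable
  have hAm : ∀ n, MeasurableSet (A n) := fun n ↦ measurableSet_lt measurable_const (hmeas n).norm
  have hvol : ∀ n, volume (A n) ≤ ENNReal.ofReal A₂ / ENNReal.ofReal δ ^ (2 : ℝ) := by
    intro n
    refine (measure_mono ?_).trans ((meas_ge_le_lintegral_div
      ((hmeas n).enorm.pow_const (2 : ℝ)).aemeasurable (by simp [hδ]) (by simp)).trans
        (ENNReal.div_le_div_right (hu₂ (u n) (hu1 n)).1 _))
    intro x hx
    have hx' : δ < ‖BesselSpace.toL2 hα (u n) x‖ := hx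
    simp only [Set.mem_ofPred_eq]
    rw [← ofReal_norm]
    gcongr
  have hsup : ENNReal.ofReal A₂ / ENNReal.ofReal δ ^ (2 : ℝ) < ⊤ :=
    ENNReal.div_lt_top ENNReal.ofReal_ne_top (by simp [hδ])
  have hunif := hK A hAm ((iSup_le hvol).trans_lt hsup)
  rw [Metric.tendstoUniformly_iff] at hunif
  have hMq : 0 < M ^ q := by positivity
  -- Uniformity in the index allows the diagonal choice: the ball of radius n is used with the n-th
  -- set itself.
  obtain ⟨n, hn⟩ := (tendsto_natCast_atTop_atTop.eventually
    (hunif (η / M ^ q) (by positivity))).exists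
  have hn' := hn n
  rw [dist_zero_left] at hn'
  have hball : MeasurableSet ((Metric.ball (0 : EuclideanSpace ℝ (Fin N)) n)ᶜ) :=
    Metric.isOpen_ball.measurableSet.compl
  have hset := (hAm n).inter hball
  have hcA : weightedMeasure c (A n ∩ (Metric.ball 0 (n : ℝ))ᶜ) ≤ ENNReal.ofReal (η / M ^ q) := by
    have hfin : IsFiniteMeasure (volume.restrict (A n ∩ (Metric.ball 0 (n : ℝ))ᶜ)) :=
      ⟨by rw [Measure.restrict_apply_univ]
          exact (measure_mono Set.inter_subset_left).trans_lt ((hvol n).trans_lt hsup)⟩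
    -- Integrability is essential here: the Bochner integral in (K) would otherwise be 0 by
    -- convention and carry no information on the c-mass.
    have hint : Integrable c (volume.restrict (A n ∩ (Metric.ball 0 (n : ℝ))ᶜ)) :=
      (hc.mono_measure Measure.restrict_le_self).integrable le_top
    rw [weightedMeasure, withDensity_apply _ hset,
      ← ofReal_integral_eq_lintegral_ofReal hint (ae_of_all _ fun x ↦ (hpos x).le)]
    exact ENNReal.ofReal_le_ofReal ((le_abs_self _).trans hn'.le)
  refine (hubad n).not_ge ?_
  rw [eLpNorm_eq_lintegral_rpow_enorm_toReal (by simpa using hq0) ENNReal.ofReal_ne_top,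
    ENNReal.toReal_ofReal hq0.le, one_div, ENNReal.rpow_inv_le_iff hq0,
    ENNReal.ofReal_rpow_of_pos hε]
  have hpt : ∀ x, ‖(Metric.ball 0 (n : ℝ))ᶜ.indicator (BesselSpace.toL2 hα (u n)) x‖ₑ ^ q ≤
      ENNReal.ofReal (δ ^ (q - 2)) * ‖BesselSpace.toL2 hα (u n) x‖ₑ ^ (2 : ℝ) +
      ENNReal.ofReal (M ^ (q - p)) * ‖BesselSpace.toL2 hα (u n) x‖ₑ ^ p +
      (A n ∩ (Metric.ball 0 (n : ℝ))ᶜ).indicator (fun _ ↦ ENNReal.ofReal (M ^ q)) x := by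
    intro x
    by_cases hx : x ∈ (Metric.ball (0 : EuclideanSpace ℝ (Fin N)) (n : ℝ))ᶜ
    · rw [Set.indicator_of_mem hx]
      have h := ENNReal.ofReal_le_ofReal (rpow_le_add_add_of_lt_of_lt
        (norm_nonneg (BesselSpace.toL2 hα (u n) x)) hδ hM hq hqp)
      rw [ENNReal.ofReal_add (by positivity) (by split_ifs <;> positivity),
        ENNReal.ofReal_add (by positivity) (by positivity), ENNReal.ofReal_mul (by positivity),
        ENNReal.ofReal_mul (by positivity),
        ← ENNReal.ofReal_rpow_of_nonneg (norm_nonneg _) hq0.le,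
        ← ENNReal.ofReal_rpow_of_nonneg (norm_nonneg _) two_pos.le,
        ← ENNReal.ofReal_rpow_of_nonneg (norm_nonneg _) hp0.le, ofReal_norm] at h
      refine h.trans_eq ?_
      congr 1
      by_cases hxA : δ < ‖BesselSpace.toL2 hα (u n) x‖
      · rw [if_pos hxA, Set.indicator_of_mem (show x ∈ A n ∩ _ from ⟨hxA, hx⟩)]
      · rw [if_neg hxA, Set.indicator_of_notMem (fun h ↦ hxA h.1), ENNReal.ofReal_zero]
    · rw [Set.indicator_of_notMem hx, enorm_zero, ENNReal.zero_rpow_of_pos hq0]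
      exact zero_le
  have h2m : Measurable fun x ↦ ENNReal.ofReal (δ ^ (q - 2)) *
      ‖BesselSpace.toL2 hα (u n) x‖ₑ ^ (2 : ℝ) := ((hmeas n).enorm.pow_const _).const_mul _
  have hpm : Measurable fun x ↦ ENNReal.ofReal (M ^ (q - p)) *
      ‖BesselSpace.toL2 hα (u n) x‖ₑ ^ p := ((hmeas n).enorm.pow_const _).const_mul _
  have hsum : Measurable fun x ↦ ENNReal.ofReal (δ ^ (q - 2)) *
      ‖BesselSpace.toL2 hα (u n) x‖ₑ ^ (2 : ℝ) + ENNReal.ofReal (M ^ (q - p)) *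
      ‖BesselSpace.toL2 hα (u n) x‖ₑ ^ p := h2m.add hpm
  refine (lintegral_mono hpt).trans ?_
  rw [lintegral_add_left hsum, lintegral_add_left h2m,
    lintegral_const_mul _ ((hmeas n).enorm.pow_const _),
    lintegral_const_mul _ ((hmeas n).enorm.pow_const _), lintegral_indicator_const hset]
  have e1 : ε ^ q = η + η + η := by rw [hη]; ring
  rw [e1, ENNReal.ofReal_add (by positivity) hη0.le, ENNReal.ofReal_add hη0.le hη0.le]
  gcongr
  · refine (mul_le_mul_right (hu₂ (u n) (hu1 n)).2 _).trans ?_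
    rw [← ENNReal.ofReal_mul (by positivity)]
    exact ENNReal.ofReal_le_ofReal hδA
  · refine (mul_le_mul_right (huₚ (u n) (hu1 n)).2 _).trans ?_
    rw [← ENNReal.ofReal_mul (by positivity)]
    exact ENNReal.ofReal_le_ofReal hMA
  · refine (mul_le_mul_right hcA _).trans ?_
    rw [← ENNReal.ofReal_mul (by positivity), mul_div_cancel₀ _ hMq.ne']

/-! ### The inclusion operator and its compact approximants on balls -/

/-- The inclusion of the Bessel space into `L^q(c dx)`. -/
theorem BesselSpace.exists_inclusion_weightedMeasure {N : ℕ} {α q : ℝ} (hα : 0 < α)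
    (hN : 2 * α < N) {c : EuclideanSpace ℝ (Fin N) → ℝ} (hc : MemLp c ⊤ volume)
    (hpos : ∀ x, 0 < c x) (hq : 2 ≤ q) (hq' : q < 2 * N / (N - 2 * α))
    [Fact (1 ≤ ENNReal.ofReal q)] :
    ∃ T : BesselSpace N hα →L[ℝ] Lp ℝ (ENNReal.ofReal q) (weightedMeasure c),
      ∀ u, T u =ᵐ[volume] BesselSpace.toL2 hα u := by
  obtain ⟨C, hC, hu⟩ := exists_eLpNorm_toL2_le hα hN hq hq'
  set D := eLpNorm c ⊤ volume ^ (1 / ENNReal.ofReal q).toReal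
  have hD' : D ≠ ⊤ := ENNReal.rpow_ne_top_of_nonneg (by positivity) hc.2.ne
  have hw : ∀ u : BesselSpace N hα, eLpNorm (BesselSpace.toL2 hα u) (ENNReal.ofReal q)
      (weightedMeasure c) ≤ D * C * ‖u‖ₑ := fun u ↦
    (eLpNorm_weightedMeasure_le c _ ENNReal.ofReal_ne_top).trans
      ((mul_le_mul_right (hu u) D).trans_eq (mul_assoc _ _ _).symm)
  have hmem : ∀ u : BesselSpace N hα,
      MemLp (BesselSpace.toL2 hα u) (ENNReal.ofReal q) (weightedMeasure c) := fun u ↦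
    ⟨(Lp.aestronglyMeasurable _).mono_ac (weightedMeasure_absolutelyContinuous c),
      (hw u).trans_lt (ENNReal.mul_lt_top (ENNReal.mul_ne_top hD' hC).lt_top enorm_lt_top)⟩
  let T : BesselSpace N hα →ₗ[ℝ] Lp ℝ (ENNReal.ofReal q) (weightedMeasure c) :=
    { toFun := fun u ↦ (hmem u).toLp
      map_add' := fun u v ↦ by
        rw [← MemLp.toLp_add, MemLp.toLp_eq_toLp_iff, map_add]
        exact (weightedMeasure_absolutelyContinuous c).ae_le (Lp.coeFn_add _ _)
      map_smul' := fun r u ↦ by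
        rw [RingHom.id_apply, ← MemLp.toLp_const_smul, MemLp.toLp_eq_toLp_iff, map_smul]
        exact (weightedMeasure_absolutelyContinuous c).ae_le (Lp.coeFn_smul _ _) }
  refine ⟨T.mkContinuous (D * C).toReal fun u ↦ ?_, fun u ↦ ?_⟩
  · have h1 : ‖T u‖ = (eLpNorm (BesselSpace.toL2 hα u) (ENNReal.ofReal q)
        (weightedMeasure c)).toReal := Lp.norm_toLp _ (hmem u)
    rw [h1, ← toReal_enorm u, ← ENNReal.toReal_mul]
    exact ENNReal.toReal_mono
      (ENNReal.mul_ne_top (ENNReal.mul_ne_top hD' hC) enorm_ne_top) (hw u)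
  · exact (absolutelyContinuous_weightedMeasure hc.1 hpos).ae_le (hmem u).coeFn_toLp

/-- On a ball, convolution with the Bessel kernel is approximated in operator norm by compact
operators. -/
theorem BesselSpace.exists_isCompactOperator_eLpNorm_sub_le {N : ℕ} {α q : ℝ} (hα : 0 < α)
    (hN : 2 * α < N) {c : EuclideanSpace ℝ (Fin N) → ℝ} (hc : MemLp c ⊤ volume)
    (hq : 2 ≤ q) (hq' : q < 2 * N / (N - 2 * α)) [Fact (1 ≤ ENNReal.ofReal q)]
    (R : ℝ) {ε : ℝ} (hε : 0 < ε) :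
    ∃ S : BesselSpace N hα →L[ℝ] Lp ℝ (ENNReal.ofReal q) (weightedMeasure c),
      IsCompactOperator S ∧ ∀ u, ‖u‖ = 1 →
        eLpNorm ((Metric.ball 0 R).indicator (BesselSpace.toL2 hα u) - ⇑(S u)) (ENNReal.ofReal q)
          (weightedMeasure c) ≤ ENNReal.ofReal ε := by
  obtain ⟨hr, hrN⟩ := two_mul_div_add_two hN hq hq'
  set D := eLpNorm c ⊤ volume ^ (1 / ENNReal.ofReal q).toReal
  have hD' : D ≠ ⊤ := ENNReal.rpow_ne_top_of_nonneg (by positivity) hc.2.ne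
  -- Passing from Lebesgue measure to c dx costs the factor D; dividing by D + 1 avoids a case D =
  -- 0. Unlike G_α, which need not be in L², the approximant K is, being continuous with compact
  -- support.
  obtain ⟨K, hKs, hKε, hKc, -⟩ :=
    (memLp_besselKernel hα hr hrN).exists_hasCompactSupport_eLpNorm_sub_le ENNReal.ofReal_ne_top
      (ε := ENNReal.ofReal (ε / (D.toReal + 1))) (by simpa using by positivity)
  have hK2 : MemLp K 2 volume := hKc.memLp_of_hasCompactSupport hKs
  have hB : MeasurableSet (Metric.ball (0 : EuclideanSpace ℝ (Fin N)) R) :=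
    Metric.isOpen_ball.measurableSet
  have hμB : weightedMeasure c (Metric.ball 0 R) ≠ ⊤ := by
    refine ne_top_of_le_ne_top ?_ (weightedMeasure_le_smul c _)
    rw [Measure.smul_apply, smul_eq_mul]
    exact ENNReal.mul_ne_top hc.2.ne measure_ball_lt_top.ne
  obtain ⟨S, hS, hSg⟩ := exists_isCompactOperator_indicator_convolution
    (p := ENNReal.ofReal q) ENNReal.ofReal_ne_top hK2 hB hμB
  let L : BesselSpace N hα →L[ℝ] Lp ℝ 2 (volume : Measure (EuclideanSpace ℝ (Fin N))) :=
    (density hα).toLinearMap.mkContinuous 1 fun u ↦ by simp [norm_eq]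
  refine ⟨S.comp L, hS.comp_clm L, fun u hu ↦ ?_⟩
  have hL : L u = density hα u := rfl
  have hdiff : (Metric.ball 0 R).indicator (toL2 hα u) - ⇑(S.comp L u) =ᵐ[weightedMeasure c]
      (Metric.ball 0 R).indicator ((besselKernel N α - K) ⋆[mul ℝ ℝ] density hα u) := by
    have h1 := hSg (density hα u)
    have h2 := (weightedMeasure_absolutelyContinuous c).ae_le (toL2_ae_eq hα u)
    have h3 := (weightedMeasure_absolutelyContinuous c).ae_le
      (ae_convolutionExistsAt_besselKernel hα (Lp.memLp (density hα u)))
    filter_upwards [h1, h2, h3] with x h1 h2 h3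
    rw [Pi.sub_apply, ContinuousLinearMap.comp_apply, hL, h1]
    by_cases hx : x ∈ Metric.ball (0 : EuclideanSpace ℝ (Fin N)) R
    · rw [Set.indicator_of_mem hx, Set.indicator_of_mem hx, Set.indicator_of_mem hx, h2]
      have hKi : Integrable (fun t ↦ K t * density hα u (x - t)) :=
        hK2.integrable_mul ((Lp.memLp (density hα u)).comp_measurePreserving
          (Measure.measurePreserving_sub_left volume x))
      simp only [convolution, ContinuousLinearMap.mul_apply', Pi.sub_apply, sub_mul]
      rw [integral_sub h3.1 hKi]
    · simp [hx]
  rw [eLpNorm_congr_ae hdiff]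
  have hg : eLpNorm (density hα u) 2 volume = 1 := by
    rw [← Lp.enorm_def, ← ofReal_norm, ← norm_eq, hu, ENNReal.ofReal_one]
  calc _ ≤ eLpNorm ((besselKernel N α - K) ⋆[mul ℝ ℝ] density hα u) (ENNReal.ofReal q)
        (weightedMeasure c) := eLpNorm_indicator_le _
    _ ≤ D * eLpNorm ((besselKernel N α - K) ⋆[mul ℝ ℝ] density hα u) (ENNReal.ofReal q)
        volume := eLpNorm_weightedMeasure_le c _ ENNReal.ofReal_ne_top
    _ ≤ D * (ENNReal.ofReal (ε / (D.toReal + 1)) * 1) := by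
        gcongr
        rw [← hg]
        refine (eLpNorm_convolution_le_of_two_le hq
          ((integrable_besselKernel hα).1.sub hKc.aestronglyMeasurable)
          (Lp.aestronglyMeasurable _)).trans ?_
        gcongr
    _ = ENNReal.ofReal (D.toReal * (ε / (D.toReal + 1))) := by
        rw [mul_one, ENNReal.ofReal_mul ENNReal.toReal_nonneg, ENNReal.ofReal_toReal hD']
    _ ≤ ENNReal.ofReal ε := by
        apply ENNReal.ofReal_le_ofReal
        have := ENNReal.toReal_nonneg (a := D)
        rw [← mul_div_assoc, div_le_iff₀ (by positivity)]
        nlinarith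

/-! ### The compact embedding -/

theorem proposition1 (N : ℕ) (α : ℝ) (hα : 0 < α) (hN : 2 * α < N)
    (c : EuclideanSpace ℝ (Fin N) → ℝ) (hc : MemLp c ⊤ volume) (hpos : ∀ x, 0 < c x)
    (hK : CompactnessConditionK c)
    (q : ℝ) (hq : 2 < q) (hq' : q < 2 * N / (N - 2 * α)) [Fact (1 ≤ ENNReal.ofReal q)] :
    ∃ T : BesselSpace N hα →L[ℝ] Lp ℝ (ENNReal.ofReal q) (weightedMeasure c),
      (∀ u, T u =ᵐ[volume] BesselSpace.toL2 hα u) ∧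
      Function.Injective T ∧ IsCompactOperator T := by
  obtain ⟨T, hT⟩ := BesselSpace.exists_inclusion_weightedMeasure hα hN hc hpos hq.le hq'
  refine ⟨T, hT, ?_, ?_⟩
  · rw [injective_iff_map_eq_zero]
    intro u hu
    have h0 : T u =ᵐ[volume] 0 := by
      rw [hu]
      exact (absolutelyContinuous_weightedMeasure hc.1 hpos).ae_le (Lp.coeFn_zero _ _ _)
    have h1 : BesselSpace.toL2 hα u = 0 :=
      (Lp.eq_zero_iff_ae_eq_zero).2 ((hT u).symm.trans h0)
    exact Subtype.ext h1
  · refine (isClosed_setOfPred_isCompactOperator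
      (σ₁₂ := RingHom.id ℝ)).closure_subset_iff.2 subset_rfl (Metric.mem_closure_iff.2 ?_)
    intro ε hε
    obtain ⟨R, hR⟩ := BesselSpace.exists_eLpNorm_indicator_compl_ball_le hα hN hc hpos hK hq hq'
      (ε := ε / 4) (by positivity)
    obtain ⟨S, hS, hSR⟩ := BesselSpace.exists_isCompactOperator_eLpNorm_sub_le hα hN hc hq.le hq' R
      (ε := ε / 4) (by positivity)
    refine ⟨S, hS, ?_⟩
    rw [dist_eq_norm]
    -- The tail and the ball contribute ε/4 each; the resulting bound ε/2 leaves room for the strict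
    -- inequality.
    refine lt_of_le_of_lt ?_ (half_lt_self hε)
    refine ContinuousLinearMap.opNorm_le_of_unit_norm (by positivity) fun u hu ↦ ?_
    rw [_root_.sub_apply, Lp.norm_def]
    refine ENNReal.toReal_le_of_le_ofReal (by positivity) ?_
    have hTu : T u =ᵐ[weightedMeasure c] BesselSpace.toL2 hα u :=
      (weightedMeasure_absolutelyContinuous c).ae_le (hT u)
    have hsplit : ↑(T u - S u) =ᵐ[weightedMeasure c]
        (Metric.ball 0 R)ᶜ.indicator (BesselSpace.toL2 hα u) +
          ((Metric.ball 0 R).indicator (BesselSpace.toL2 hα u) - ⇑(S u)) := by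
      filter_upwards [Lp.coeFn_sub (T u) (S u), hTu] with x h1 h2
      rw [h1, Pi.sub_apply, h2, Pi.add_apply, Pi.sub_apply, ← add_sub_assoc,
        Set.indicator_compl_add_self_apply]
    have hm : AEStronglyMeasurable (BesselSpace.toL2 hα u) (weightedMeasure c) :=
      (Lp.aestronglyMeasurable _).mono_ac (weightedMeasure_absolutelyContinuous c)
    have hB : MeasurableSet (Metric.ball (0 : EuclideanSpace ℝ (Fin N)) R) :=
      Metric.isOpen_ball.measurableSet
    rw [eLpNorm_congr_ae hsplit]
    refine (eLpNorm_add_le (hm.indicator hB.compl)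
      ((hm.indicator hB).sub (Lp.aestronglyMeasurable _)) Fact.out).trans ?_
    refine (add_le_add (hR u hu) (hSR u hu)).trans_eq ?_
    rw [← ENNReal.ofReal_add (by positivity) (by positivity)]
    congr 1
    ring

end
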